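/- Let $K=\mathbb{Q}(i)$ or $K=\mathbb{Q}(\omega)$ with $\omega=e^{2\pi i/3}$. Let $L\subset\mathbb{C}$ be a finite Galois extension of $K$ of degree $n$ whose Galois group is cyclic, generated by $\sigma$. Let $\gamma\in\mathcal{O}_K$ be such that none of $\gamma,\gamma^2,\dots,\gamma^{n-1}$ is the norm $N_{L/K}(y)$ of an element $y\in L$ (so that the cyclic algebra $(L/K,\sigma,\gamma)$ is a division algebra). Let $\mathfrak{I}=\alpha\mathcal{O}_L$ with $0\neq\alpha\in\mathcal{O}_L$, and for $x=(x_0,\dots,x_{n-1})\in\mathcal{O}_L^n$ let $$X(x)=\mathrm{diag}\bigl(\alpha,\sigma(\alpha),\dots,\sigma^{n-1}(\alpha)\bigr)\begin{pmatrix}x_0&x_1&\cdots&x_{n-1}\\ \gamma\sigma(x_{n-1})&\sigma(x_0)&\cdots&\sigma(x_{n-2})\\ \vdots&&\ddots&\vdots\\ \gamma\sigma^{n-1}(x_1)&\gamma\sigma^{n-1}(x_2)&\cdots&\sigma^{n-1}(x_0)\end{pmatrix}.$$ Let $\mathfrak{q}_1,\dots,\mathfrak{q}_m$ be nonzero, pairwise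 coprime ideals of $\mathcal{O}_L$, let $\mathfrak{q}=\mathfrak{q}_1\cdots\mathfrak{q}_m$, and let $\mathcal{M}:\prod_k\mathcal{O}_L/\mathfrak{q}_k\to\mathcal{O}_L$ assign to each residue tuple a representative in $\mathcal{O}_L$ (the inverse Chinese remainder isomorphism followed by a choice of coset leaders of $\mathcal{O}_L/\mathfrak{q}$). The $k$-th message is $w_k=(w_{k,0},\dots,w_{k,n-1})\in(\mathcal{O}_L/\mathfrak{q}_k)^n$. The layered space-time index code (LSTIC) sends $(w_1,\dots,w_m)$ to $X(x)$ with $x_\ell=\mathcal{M}(w_{1,\ell},\dots,w_{m,\ell})$; let $\mathcal{C}$ be the set of all codewords. For $\mathcal{S}\subseteq\{1,\dots,m\}$ and given message values $v_s$, $s\in\mathcal{S}$, let $\mathcal{C}_{\mathcal{S}}$ be the set of codewords of message tuples with $w_s=v_s$ for all $s\in\mathcal{S}$. As lattice codes, i.e. with each layer $x_\ell$ read modulo $\mathfrak{q}$, the codes $\mathcal{C}$ and $\mathcal{C}_{\mathcal{S}}$ stand for $\mathcal{C}+X(\mathfrak{q}^n)$ and $\mathcal{C}_{\mathcal{S}}+X(\mathfrak{q}^n)$,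 where $X(\mathfrak{q}^n)=\{X(z): z_0,\dots,z_{n-1}\in\mathfrak{q}\}$. For a code $\mathcal{D}$ let $\delta(\mathcal{D})=\min_{X\neq X'\in\mathcal{D}}\det\bigl((X-X')(X-X')^{\dagger}\bigr)$. Let $R_{\mathcal{S}}=\sum_{s\in\mathcal{S}}\frac{1}{2n^2}\log_2\bigl|(\mathcal{O}_L/\mathfrak{q}_s)^n\bigr|$ be the rate of the side information in bits per real symbol, and let the normalized side information gain be $$\Gamma(\mathcal{C},\mathcal{S})=\frac{10\log_{10}\bigl(\delta(\mathcal{C}_{\mathcal{S}})/\delta(\mathcal{C})\bigr)}{n\,R_{\mathcal{S}}}.$$ **Theorem.** Let $\mathcal{S}\subseteq\{1,\dots,m\}$ be such that $\mathfrak{q}_s\neq\mathcal{O}_L$ for at least one $s\in\mathcal{S}$; that is, $R_{\mathcal{S}}>0$. Let the values $v_s$, $s\in\mathcal{S}$, be arbitrary. (1) For the minimum determinants of the lattice codes $\mathcal{C}+X(\mathfrak{q}^n)$ and $\mathcal{C}_{\mathcal{S}}+X(\mathfrak{q}^n)$ (both minima are attained and positive), $\Gamma(\mathcal{C},\mathcal{S})\ge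 20\log_{10}2\approx 6.02$ (the "6 dB" per bit per real symbol). If moreover all $\mathfrak{q}_k$ are principal, then $\Gamma(\mathcal{C},\mathcal{S})=20\log_{10}2$. (2) If the coset leaders $\mathcal{M}(b)$ have minimum energy $\sum_{i=0}^{n-1}|\sigma^i(x)|^2$ in their cosets modulo $\mathfrak{q}$, and $\mathfrak{q}_k\neq\mathcal{O}_L$ for some $k\notin\mathcal{S}$ (so that $\mathcal{C}_{\mathcal{S}}$ has more than one codeword), then also for the minimum determinants of the finite codebooks $\mathcal{C}$ and $\mathcal{C}_{\mathcal{S}}$ themselves (again attained and positive), $\Gamma(\mathcal{C},\mathcal{S})\ge 20\log_{10}2$. -/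

import Mathlib

open scoped NumberField Matrix

noncomputable section

namespace LSTIC

section MinimumDeterminant

variable {n : ℕ}

/-- The values `det ((X - X')(X - X')ᴴ)` over all pairs of distinct codewords of a code `C`.
Each determinant is a nonnegative real number; `re` reads it as such. -/
def pairDets (C : Set (Matrix (Fin n) (Fin n) ℂ)) : Set ℝ :=
  {d | ∃ X ∈ C, ∃ X' ∈ C, X ≠ X' ∧ d = ((X - X') * (X - X')ᴴ).det.re}

/-- The minimum determinant `δ(C)`. -/
def minDet (C : Set (Matrix (Fin n) (Fin n) ℂ)) : ℝ := sInf (pairDets C)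

/-- `δ(C)` is a genuine minimum (it is attained) and it is positive. -/
def HasMinDet (C : Set (Matrix (Fin n) (Fin n) ℂ)) : Prop :=
  IsLeast (pairDets C) (minDet C) ∧ 0 < minDet C

/-- The normalized side information gain (in dB per bit per real symbol) of a code `C` of
`n × n` matrices (`n` transmit antennas) with subcode `CS`, when the rate of the side
information is `R` bits per real symbol. -/
def sideInfoGain (C CS : Set (Matrix (Fin n) (Fin n) ℂ)) (R : ℝ) : ℝ :=
  10 * Real.logb 10 (minDet CS / minDet C) / (n * R)

end MinimumDeterminant

section Code

variable {K L : Type*} [Field K] [NumberField K] [Field L] [NumberField L] [Algebra K L]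
variable {n m : ℕ}

/-- The matrix form of the element `x₀ + x₁ e + ⋯ + xₙ₋₁ eⁿ⁻¹` of the cyclic algebra
`(L/K, σ, γ)`: the entry in row `i`, column `j` is `σⁱ(xⱼ₋ᵢ)` if `i ≤ j` and
`γ σⁱ(xₙ₊ⱼ₋ᵢ)` if `i > j` (subtraction in `Fin n` is modulo `n`). -/
def cyclicMatrix (σ : L ≃ₐ[K] L) (γ : 𝓞 K) (x : Fin n → 𝓞 L) : Matrix (Fin n) (Fin n) L :=
  Matrix.of fun i j =>
    (if i ≤ j then 1 else algebraMap K L (γ : K)) * (σ ^ (i : ℕ)) ((x (j - i) : 𝓞 L) : L)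

/-- The complex matrix `D(α) · (matrix of x₀ + x₁ e + ⋯ + xₙ₋₁ eⁿ⁻¹)` with
`D(α) = diag(α, σ(α), …, σⁿ⁻¹(α))`; the number field `L` is viewed inside `ℂ` through `ι`. -/
def codeword (ι : L →+* ℂ) (σ : L ≃ₐ[K] L) (γ : 𝓞 K) (α : 𝓞 L) (x : Fin n → 𝓞 L) :
    Matrix (Fin n) (Fin n) ℂ :=
  (Matrix.diagonal (fun i : Fin n => (σ ^ (i : ℕ)) (α : L)) * cyclicMatrix σ γ x).map ι

/-- The energy `∑_{i < n} |σⁱ(x)|²` of a symbol `x`. -/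
def energy (n : ℕ) (ι : L →+* ℂ) (σ : L ≃ₐ[K] L) (x : 𝓞 L) : ℝ :=
  ∑ i ∈ Finset.range n, ‖ι ((σ ^ i) (x : L))‖ ^ 2

/-- `M` inverts the Chinese remainder isomorphism `𝓞_L/(q₁⋯q_m) ≃ ∏ 𝓞_L/q_k`, with values in a
complete set of coset leaders: `M b` is an element of `𝓞_L` with residues `b`. -/
def IsLeaderMap (q : Fin m → Ideal (𝓞 L)) (M : ((k : Fin m) → 𝓞 L ⧸ q k) → 𝓞 L) : Prop :=
  ∀ b k, Ideal.Quotient.mk (q k) (M b) = b k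

/-- Each coset leader has minimum energy in its coset. -/
def HasMinEnergy (n : ℕ) (ι : L →+* ℂ) (σ : L ≃ₐ[K] L) (q : Fin m → Ideal (𝓞 L))
    (M : ((k : Fin m) → 𝓞 L ⧸ q k) → 𝓞 L) : Prop :=
  ∀ b, ∀ x : 𝓞 L, (∀ k, Ideal.Quotient.mk (q k) x = b k) →
    energy n ι σ (M b) ≤ energy n ι σ x

/-- The message tuples `(w₁, …, w_m)`, where `w_k = (w_{k,0}, …, w_{k,n-1}) ∈ (𝓞_L/q_k)ⁿ`. -/
abbrev Messages (n : ℕ) (q : Fin m → Ideal (𝓞 L)) : Type _ :=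
  (k : Fin m) → Fin n → 𝓞 L ⧸ q k

/-- The layered encoder: layer `ℓ` carries `x_ℓ = M(w_{1,ℓ}, …, w_{m,ℓ})`. -/
def encode (ι : L →+* ℂ) (σ : L ≃ₐ[K] L) (γ : 𝓞 K) (α : 𝓞 L) (q : Fin m → Ideal (𝓞 L))
    (M : ((k : Fin m) → 𝓞 L ⧸ q k) → 𝓞 L) (w : Messages n q) : Matrix (Fin n) (Fin n) ℂ :=
  codeword ι σ γ α fun l => M fun k => w k l

/-- The codebook `C` of all codewords. -/
def codebook (ι : L →+* ℂ) (σ : L ≃ₐ[K] L) (γ : 𝓞 K) (α : 𝓞 L) (q : Fin m → Ideal (𝓞 L))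
    (M : ((k : Fin m) → 𝓞 L ⧸ q k) → 𝓞 L) : Set (Matrix (Fin n) (Fin n) ℂ) :=
  {X | ∃ w : Messages n q, X = encode ι σ γ α q M w}

/-- The subcode `C_S` of the codewords compatible with the side information `w_s = v_s`,
`s ∈ S`. -/
def subcode (ι : L →+* ℂ) (σ : L ≃ₐ[K] L) (γ : 𝓞 K) (α : 𝓞 L) (q : Fin m → Ideal (𝓞 L))
    (M : ((k : Fin m) → 𝓞 L ⧸ q k) → 𝓞 L) (S : Finset (Fin m)) (v : Messages n q) :
    Set (Matrix (Fin n) (Fin n) ℂ) :=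
  {X | ∃ d : Messages n q, (∀ k ∈ S, d k = v k) ∧ X = encode ι σ γ α q M d}

/-- The lattice code from which a code `C` is carved when every layer `x_ℓ` is read modulo
`q₁⋯q_m`: all translates of the codewords of `C` by the matrices of the sublattice of those
`x` with all `x_ℓ ∈ q₁⋯q_m`. -/
def latticeCode (ι : L →+* ℂ) (σ : L ≃ₐ[K] L) (γ : 𝓞 K) (α : 𝓞 L) (q : Fin m → Ideal (𝓞 L))
    (C : Set (Matrix (Fin n) (Fin n) ℂ)) : Set (Matrix (Fin n) (Fin n) ℂ) :=
  {Y | ∃ X ∈ C, ∃ z : Fin n → 𝓞 L, (∀ l, z l ∈ ∏ k, q k) ∧ Y = X + codeword ι σ γ α z}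

/-- The rate `R_S = ∑_{s ∈ S} log₂(M_s) / (2n²)` of the side information in bits per real
symbol: message `w_s` takes `M_s = |(𝓞_L/q_s)ⁿ|` values, and a codeword carries `2n²` real
symbols. -/
def sideInfoRate (n : ℕ) (q : Fin m → Ideal (𝓞 L)) (S : Finset (Fin m)) : ℝ :=
  ∑ s ∈ S, Real.logb 2 (Nat.card (Fin n → 𝓞 L ⧸ q s)) / (2 * (n : ℝ) ^ 2)

end Code

end LSTIC

end

/-!
A nonzero codeword `X(x)` is the matrix of a nonzero element of a division algebra, so its reduced
norm does not vanish: otherwise the row space of the matrix, of dimension `0 < t < n` over `L`, is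
stable under the `σ`-semilinear map of multiplication by `e`, whose `n`-th power is the scalar `γ`,
and taking determinants on it exhibits `γᵗ` as a norm. The reduced norm is an algebraic integer
fixed by `σ`, hence lies in `𝓞_K`. As `K` is imaginary quadratic, the squared absolute value of an
element of `𝓞_K` is its ideal norm; and if all `x_l` lie in an ideal `Q` of `𝓞_L`, then row `i` of
the matrix lies in `σⁱ(Q)`, so the ideal norm of the reduced norm is at least `N(Q)`. Hence knowing
the residues modulo `q_s`, `s ∈ S`, multiplies the minimum determinant `N(α)` by at least
`N(∏ q_s) = 2 ^ (2 n R_S)`, and by exactly this when `∏ q_s` has a generator to put into the code.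

For the finite codebook, the minimum `N(α)` is still attained by the codewords of the tuples
`(0, …, 0)` and `(1, 0, …, 0)`: the leader of the coset of `1` has energy at most that of `1`, which
is `n`, so by the inequality of arithmetic and geometric means its norm is at most `1`.
-/

namespace LSTIC

section Semilinear

variable {G R W : Type*} [Monoid G] [CommRing R] [MulSemiringAction G R] [AddCommGroup W]
  [Module R W] {ν : Type*} [Fintype ν] [DecidableEq ν]

theorem det_semilinear_comp (b : Module.Basis ν R W) {g : G}
    (E : W →ₛₗ[MulSemiringAction.toRingHom G R g] W) (v : ν → W) :
    b.det (E ∘ v) = g • b.det v * b.det (E ∘ b) := by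
  have hE : b.toMatrix (E ∘ v) =
      b.toMatrix (E ∘ b) * (MulSemiringAction.toRingHom G R g).mapMatrix (b.toMatrix v) := by
    ext i j
    have hsum : E (v j) = ∑ k, (g • b.repr (v j) k) • E (b k) := by
      conv_lhs => rw [← b.sum_repr (v j), map_sum]
      simp only [LinearMap.map_smulₛₗ, MulSemiringAction.toRingHom_apply]
    simp only [Matrix.mul_apply, Module.Basis.toMatrix_apply, Function.comp_apply, hsum, map_sum,
      map_smul, Finsupp.coe_finsetSum, Finset.sum_apply, Finsupp.smul_apply, smul_eq_mul,
      RingHom.mapMatrix_apply, Matrix.map_apply, MulSemiringAction.toRingHom_apply, mul_comm]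
  rw [b.det_apply, b.det_apply, b.det_apply, hE, Matrix.det_mul, ← RingHom.map_det, mul_comm,
    MulSemiringAction.toRingHom_apply]

theorem det_semilinear_iterate (b : Module.Basis ν R W) {g : G}
    (E : W →ₛₗ[MulSemiringAction.toRingHom G R g] W) (k : ℕ) :
    b.det (E^[k] ∘ b) = ∏ i ∈ Finset.range k, g ^ i • b.det (E ∘ b) := by
  induction k with
  | zero => simp [Function.iterate_zero, b.det_self]
  | succ k ih =>
    rw [Function.iterate_succ', Function.comp_assoc, det_semilinear_comp, ih, Finset.smul_prod',
      Finset.prod_range_succ', pow_zero, one_smul]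
    simp only [smul_smul, pow_succ']

theorem exists_prod_smul_eq_pow [Module.Free R W] [Module.Finite R W] [Nontrivial R] {g : G}
    (E : W →ₛₗ[MulSemiringAction.toRingHom G R g] W) {n : ℕ} {c : R}
    (hE : ∀ w, E^[n] w = c • w) :
    ∃ p : R, ∏ i ∈ Finset.range n, g ^ i • p = c ^ Module.finrank R W := by
  let b := Module.finBasis R W
  refine ⟨b.det (E ∘ b), ?_⟩
  have hscale : E^[n] ∘ b = fun j => c • b j := funext fun j => hE (b j)
  rw [← det_semilinear_iterate, hscale, b.det.map_smul_univ, b.det_self, Finset.prod_const,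
    Finset.card_univ, Fintype.card_fin, smul_eq_mul, mul_one]

end Semilinear

section TwistedCirculant

variable {G R : Type*} [Monoid G] [CommRing R] [MulSemiringAction G R] {n : ℕ}

/-- The matrix, in the basis `1, e, …, eⁿ⁻¹`, of right multiplication by `∑ xⱼ eʲ` on the cyclic
algebra in which `eⁿ = c` and `e * r = (g • r) * e`. It extends `cyclicMatrix` from fields to
rings, so that it can be formed over the ring of integers. -/
def twistedCirculant (g : G) (c : R) (x : Fin n → R) : Matrix (Fin n) (Fin n) R :=
  .of fun i j => (if i ≤ j then 1 else c) * g ^ (i : ℕ) • x (j - i)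

theorem twistedCirculant_apply (g : G) (c : R) (x : Fin n → R) (i j : Fin n) :
    twistedCirculant g c x i j = (if i ≤ j then 1 else c) * g ^ (i : ℕ) • x (j - i) := rfl

theorem twistedCirculant_sub (g : G) (c : R) (x y : Fin n → R) :
    twistedCirculant g c (x - y) = twistedCirculant g c x - twistedCirculant g c y := by
  ext i j
  simp only [twistedCirculant_apply, Matrix.sub_apply, Pi.sub_apply, smul_sub, mul_sub]

theorem map_twistedCirculant {S : Type*} [CommRing S] [MulSemiringAction G S] [Algebra R S]
    [SMulDistribClass G R S] (g : G) (c : R) (x : Fin n → R) :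
    (twistedCirculant g c x).map (algebraMap R S) =
      twistedCirculant g (algebraMap R S c) (algebraMap R S ∘ x) := by
  ext i j
  simp only [twistedCirculant_apply, Matrix.map_apply, map_mul, algebraMap.smul',
    apply_ite (algebraMap R S), map_one, Function.comp_apply]

variable [NeZero n]

theorem twistedCirculant_single (g : G) (c y : R) :
    twistedCirculant g c (Pi.single (0 : Fin n) y) =
      Matrix.diagonal fun i : Fin n => g ^ (i : ℕ) • y := by
  ext i j
  rcases eq_or_ne i j with rfl | h
  · simp [twistedCirculant_apply]
  · simp [twistedCirculant_apply, Matrix.diagonal_apply_ne _ h, sub_ne_zero.mpr h.symm]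

/-- The factor `eⁿ = c` picked up by `eⁱ⁻¹ * e` when the index wraps around to `i = 0`. -/
def wrapFactor (c : R) (i : Fin n) : R := if i = 0 then c else 1

/-- Left multiplication by `e` on the cyclic algebra with `eⁿ = c` and `e * r = (g • r) * e`, in
the basis `1, e, …, eⁿ⁻¹`. -/
def twistedShift (g : G) (c : R) :
    (Fin n → R) →ₛₗ[MulSemiringAction.toRingHom G R g] (Fin n → R) where
  toFun v i := wrapFactor c i * g • v (i - 1)
  map_add' v w := by ext i; simp [mul_add]
  map_smul' r v := by ext i; simp [mul_left_comm]

theorem twistedShift_apply (g : G) (c : R) (v : Fin n → R) (i : Fin n) :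
    twistedShift g c v i = wrapFactor c i * g • v (i - 1) := rfl

theorem prod_wrapFactor_add_one (c : R) : ∏ i : Fin n, wrapFactor c (i + 1) = c := by
  calc ∏ i : Fin n, wrapFactor c (i + 1) = ∏ i : Fin n, wrapFactor c i :=
        Equiv.prod_comp (Equiv.addRight (1 : Fin n)) (wrapFactor c)
    _ = c := by simp [wrapFactor]

theorem twistedShift_single (g : G) (c : R) (i : Fin n) :
    twistedShift g c (Pi.single i 1) = wrapFactor c (i + 1) • Pi.single (i + 1) 1 := by
  ext j
  rcases eq_or_ne j (i + 1) with rfl | h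
  · simp [twistedShift_apply]
  · simp [twistedShift_apply, h, Pi.single_eq_of_ne (fun hj => h (sub_eq_iff_eq_add.mp hj))]

theorem wrapFactor_mul_ite (c : R) {k : ℕ} (hk : k < n) (i : Fin n) :
    wrapFactor c i * (if ((i - 1 : Fin n) : ℕ) < k then c else 1) =
      if (i : ℕ) < k + 1 then c else 1 := by
  rcases eq_or_ne i 0 with rfl | hi
  · have hlast : ¬ ((0 - 1 : Fin n) : ℕ) < k := by
      obtain ⟨n, rfl⟩ := Nat.exists_eq_succ_of_ne_zero (NeZero.ne n)
      rw [zero_sub, Fin.coe_neg_one]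
      lia
    rw [if_neg hlast]
    simp [wrapFactor]
  · have hiff : (i : ℕ) - 1 < k ↔ (i : ℕ) < k + 1 := by
      have := Fin.val_ne_zero_iff.mpr hi
      lia
    rw [wrapFactor, if_neg hi, one_mul, Fin.val_sub_one_of_ne_zero hi]
    simp only [hiff]

theorem twistedShift_iterate_apply {g : G} {c : R} (hc : g • c = c) (v : Fin n → R) {k : ℕ}
    (hk : k ≤ n) (i : Fin n) :
    (twistedShift g c)^[k] v i =
      (if (i : ℕ) < k then c else 1) * g ^ k • v (i - Fin.ofNat n k) := by
  induction k generalizing i with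
  | zero => simp
  | succ k ih =>
    have hidx : i - 1 - Fin.ofNat n k = i - Fin.ofNat n (k + 1) := by
      rw [sub_sub]
      congr 1
      ext
      simp [Fin.val_add, add_comm]
    rw [Function.iterate_succ_apply', twistedShift_apply, ih (by lia), smul_mul', smul_ite, hc,
      smul_one, ← mul_assoc, wrapFactor_mul_ite c hk, hidx, smul_smul, pow_succ']

theorem twistedShift_iterate_self {g : G} (hg : g ^ n = 1) {c : R} (hc : g • c = c)
    (v : Fin n → R) : (twistedShift g c)^[n] v = c • v := by
  ext i
  have hn : Fin.ofNat n n = 0 := by ext; simp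
  rw [twistedShift_iterate_apply hc v le_rfl, if_pos i.isLt, hg, one_smul, hn, sub_zero]
  rfl

theorem row_twistedCirculant {g : G} {c : R} (hc : g • c = c) (x : Fin n → R) (i : Fin n) :
    (twistedCirculant g c x).row i = (twistedShift g c)^[i] x := by
  ext j
  rw [Matrix.row_apply, twistedShift_iterate_apply hc x i.isLt.le, twistedCirculant_apply,
    Fin.ofNat_eq_cast, Fin.cast_val_eq_self]
  simp only [← Fin.lt_def, ← not_lt, ite_not]

theorem twistedShift_row_twistedCirculant {g : G} (hg : g ^ n = 1) {c : R} (hc : g • c = c)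
    (x : Fin n → R) (i : Fin n) :
    twistedShift g c ((twistedCirculant g c x).row i) =
      wrapFactor c (i + 1) • (twistedCirculant g c x).row (i + 1) := by
  rw [row_twistedCirculant hc, row_twistedCirculant hc,
    ← Function.iterate_succ_apply' (twistedShift g c)]
  obtain ⟨n, rfl⟩ : ∃ k, n = k + 1 := Nat.exists_eq_succ_of_ne_zero (NeZero.ne n)
  rcases eq_or_ne i (Fin.last n) with rfl | hi
  · rw [Fin.val_last, twistedShift_iterate_self hg hc]
    simp [wrapFactor]
  · have hval : ((i + 1 : Fin (n + 1)) : ℕ) = i + 1 :=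
      Fin.val_add_one_of_lt (Fin.lt_last_iff_ne_last.mpr hi)
    have h0 : i + 1 ≠ 0 := fun h => by simp [h] at hval
    rw [hval, wrapFactor, if_neg h0, one_smul]

theorem smul_det_twistedCirculant [IsDomain R] {g : G} (hg : g ^ n = 1) {c : R} (hc : g • c = c)
    (hc0 : c ≠ 0) (x : Fin n → R) :
    g • (twistedCirculant g c x).det = (twistedCirculant g c x).det := by
  let b := Pi.basisFun R (Fin n)
  let ε := Equiv.Perm.sign (Equiv.addRight (1 : Fin n))
  have hrotate (v : Fin n → Fin n → R) :
      b.det (fun i => wrapFactor c (i + 1) • v (i + 1)) = c * ε • b.det v := by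
    rw [b.det.map_smul_univ (fun i => wrapFactor c (i + 1)) fun i => v (i + 1),
      prod_wrapFactor_add_one, smul_eq_mul]
    exact congrArg (c * ·) (b.det.map_perm v (Equiv.addRight 1))
  have hdet (A : Matrix (Fin n) (Fin n) R) : b.det A.row = A.det := Pi.basisFun_det_apply A
  have hrows := det_semilinear_comp b (twistedShift g c) (twistedCirculant g c x).row
  have hA : twistedShift g c ∘ (twistedCirculant g c x).row = fun i =>
      wrapFactor c (i + 1) • (twistedCirculant g c x).row (i + 1) :=
    funext fun i => twistedShift_row_twistedCirculant hg hc x i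
  have hb : twistedShift g c ∘ b = fun i => wrapFactor c (i + 1) • b (i + 1) :=
    funext fun i => by simp only [Function.comp_apply, b, Pi.basisFun_apply, twistedShift_single]
  rw [hA, hb, hrotate, hrotate, b.det_self, hdet, mul_left_comm _ c] at hrows
  have hsign := mul_left_cancel₀ hc0 hrows
  rw [mul_smul_comm, mul_one] at hsign
  exact (MulAction.injective ε hsign).symm

theorem exists_prod_smul_eq_pow_of_det_eq_zero {L : Type*} [Field L] [MulSemiringAction G L]
    {g : G} (hg : g ^ n = 1) {c : L} (hc : g • c = c) {x : Fin n → L} (hx : x ≠ 0)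
    (hdet : (twistedCirculant g c x).det = 0) :
    ∃ t, 0 < t ∧ t < n ∧ ∃ p : L, ∏ i ∈ Finset.range n, g ^ i • p = c ^ t := by
  let A := twistedCirculant g c x
  let V := Submodule.span L (Set.range A.row)
  have hstable : ∀ v ∈ V, twistedShift g c v ∈ V := by
    suffices h : V ≤ V.comap (twistedShift g c) from h
    refine Submodule.span_le.mpr ?_
    rintro _ ⟨i, rfl⟩
    rw [SetLike.mem_coe, Submodule.mem_comap, twistedShift_row_twistedCirculant hg hc]
    exact V.smul_mem _ (Submodule.subset_span ⟨i + 1, rfl⟩)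
  let E : V →ₛₗ[MulSemiringAction.toRingHom G L g] V := (twistedShift g c).restrict hstable
  have hE (w : V) : E^[n] w = c • w := by
    have hcoe : Function.Semiconj ((↑) : V → Fin n → L) E (twistedShift g c) := fun _ => rfl
    exact Subtype.ext ((hcoe.iterate_right n w).trans (twistedShift_iterate_self hg hc w))
  have hpos : 0 < Module.finrank L V := by
    have hxV : x ∈ V := Submodule.subset_span ⟨0, row_twistedCirculant hc x 0⟩
    exact Module.finrank_pos_iff_exists_ne_zero.mpr
      ⟨⟨x, hxV⟩, fun h => hx (congrArg Subtype.val h)⟩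
  have hlt : Module.finrank L V < n := by
    by_contra! hle
    have hrows : LinearIndependent L A.row :=
      linearIndependent_iff_card_le_finrank_span.mpr (by rwa [Fintype.card_fin])
    have hunit := A.isUnit_iff_isUnit_det.mp (Matrix.linearIndependent_rows_iff_isUnit.mp hrows)
    exact hunit.ne_zero hdet
  exact ⟨_, hpos, hlt, exists_prod_smul_eq_pow E hE⟩

end TwistedCirculant

section CyclicExtension

variable {K L : Type*} [Field K] [Field L] [Algebra K L]

/-- `σ` generates the Galois group of the extension `L/K` of degree `n`. -/
structure IsGaloisGenerator (n : ℕ) (σ : L ≃ₐ[K] L) : Prop where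
  finrank_eq : Module.finrank K L = n
  mem_zpowers : ∀ τ : L ≃ₐ[K] L, τ ∈ Subgroup.zpowers σ

/-- `c` is a non-norm element for the cyclic extension `L/K` of degree `n` with generator `σ`,
which makes the cyclic algebra `(L/K, σ, c)` a division algebra. -/
structure IsNonNorm (n : ℕ) (σ : L ≃ₐ[K] L) (c : K) : Prop extends IsGaloisGenerator n σ where
  norm_ne_pow : ∀ j : ℕ, 1 ≤ j → j < n → ∀ y : L, Algebra.norm K y ≠ c ^ j

variable [FiniteDimensional K L] {n : ℕ} {σ : L ≃ₐ[K] L} {c : K}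

theorem IsGaloisGenerator.neZero (h : IsGaloisGenerator n σ) : NeZero n :=
  ⟨h.finrank_eq ▸ Module.finrank_pos.ne'⟩

variable [IsGalois K L]

theorem IsGaloisGenerator.orderOf_eq (h : IsGaloisGenerator n σ) : orderOf σ = n := by
  rw [orderOf_eq_card_of_forall_mem_zpowers h.mem_zpowers, IsGalois.card_aut_eq_finrank,
    h.finrank_eq]

theorem IsGaloisGenerator.pow_eq_one (h : IsGaloisGenerator n σ) : σ ^ n = 1 :=
  orderOf_dvd_iff_pow_eq_one.mp h.orderOf_eq.dvd

theorem IsGaloisGenerator.algebraMap_norm (h : IsGaloisGenerator n σ) (y : L) :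
    algebraMap K L (Algebra.norm K y) = ∏ i ∈ Finset.range n, σ ^ i • y := by
  classical
  rw [Algebra.norm_eq_prod_automorphisms, ← IsCyclic.image_range_orderOf h.mem_zpowers,
    Finset.prod_image, h.orderOf_eq]
  · rfl
  · simpa only [Finset.coe_range] using pow_injOn_Iio_orderOf

theorem IsNonNorm.det_twistedCirculant_ne_zero [NeZero n] (h : IsNonNorm n σ c) {x : Fin n → L}
    (hx : x ≠ 0) : (twistedCirculant σ (algebraMap K L c) x).det ≠ 0 := by
  intro hdet
  obtain ⟨t, ht0, htn, p, hp⟩ := exists_prod_smul_eq_pow_of_det_eq_zero h.pow_eq_one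
    (smul_algebraMap σ c) hx hdet
  rw [← h.algebraMap_norm, ← map_pow] at hp
  exact h.norm_ne_pow t ht0 htn p ((algebraMap K L).injective hp)

end CyclicExtension

section IdealNorm

open scoped Pointwise

theorem det_mem_prod_of_forall_mem {R ν : Type*} [CommRing R] [Fintype ν] [DecidableEq ν]
    {A : Matrix ν ν R} {I : ν → Ideal R} (h : ∀ i j, A i j ∈ I i) : A.det ∈ ∏ i, I i := by
  rw [← Matrix.det_transpose, Matrix.det_apply']
  exact Ideal.sum_mem _ fun τ _ =>
    Ideal.mul_mem_left _ _ (Ideal.prod_mem_prod fun i _ => h i (τ i))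

theorem det_twistedCirculant_mem_prod {G R : Type*} [Monoid G] [CommRing R]
    [MulSemiringAction G R] {n : ℕ} (g : G) (c : R) {x : Fin n → R} {Q : Ideal R}
    (hx : ∀ l, x l ∈ Q) : (twistedCirculant g c x).det ∈ ∏ i : Fin n, g ^ (i : ℕ) • Q :=
  det_mem_prod_of_forall_mem fun _ _ =>
    Ideal.mul_mem_left _ _ (Ideal.smul_mem_pointwise_smul _ _ _ (hx _))

theorem absNorm_smul {G R : Type*} [Group G] [CommRing R] [MulSemiringAction G R]
    [IsDedekindDomain R] [Module.Free ℤ R] (g : G) (I : Ideal R) :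
    Ideal.absNorm (g • I) = Ideal.absNorm I := by
  rw [Ideal.absNorm_apply, Ideal.absNorm_apply, Submodule.cardQuot_apply,
    Submodule.cardQuot_apply]
  exact (Nat.card_congr
    (Ideal.quotientEquiv I (g • I) (MulSemiringAction.toRingEquiv G R g) rfl).toEquiv).symm

theorem absNorm_pos {R : Type*} [CommRing R] [IsDedekindDomain R] [Module.Free ℤ R]
    [Module.Finite ℤ R] {I : Ideal R} (hI : I ≠ ⊥) : 0 < Ideal.absNorm I :=
  Nat.pos_of_ne_zero (mt Ideal.absNorm_eq_zero_iff.mp hI)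

end IdealNorm

section ReducedNorm

variable {K L : Type*} [Field K] [Field L] [Algebra K L] {n : ℕ}

/-- The reduced norm of the element `∑ xⱼ eʲ` of the natural order of `(L/K, σ, γ)`. It lies in
`𝓞 K`, but is encoded as an element of `𝓞 L`, where the determinant lives. -/
def reducedNorm (σ : L ≃ₐ[K] L) (γ : 𝓞 K) (x : Fin n → 𝓞 L) : 𝓞 L :=
  (twistedCirculant σ (algebraMap (𝓞 K) (𝓞 L) γ) x).det

theorem cyclicMatrix_eq_twistedCirculant (σ : L ≃ₐ[K] L) (γ : 𝓞 K) (x : Fin n → 𝓞 L) :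
    cyclicMatrix σ γ x = twistedCirculant σ (algebraMap K L γ) fun l => (x l : L) := rfl

theorem coe_reducedNorm (σ : L ≃ₐ[K] L) (γ : 𝓞 K) (x : Fin n → 𝓞 L) :
    (reducedNorm σ γ x : L) = (cyclicMatrix σ γ x).det := by
  refine (RingHom.map_det (algebraMap (𝓞 L) L) _).trans ?_
  rw [RingHom.mapMatrix_apply, map_twistedCirculant, cyclicMatrix_eq_twistedCirculant]
  rfl

variable [NumberField K] [NumberField L] [IsGalois K L] {σ : L ≃ₐ[K] L} {γ : 𝓞 K}

theorem IsNonNorm.reducedNorm_ne_zero [NeZero n] (h : IsNonNorm n σ (γ : K)) {x : Fin n → 𝓞 L}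
    (hx : x ≠ 0) : reducedNorm σ γ x ≠ 0 := by
  have hx' : (fun l => (x l : L)) ≠ 0 := fun h0 =>
    hx (funext fun l => NumberField.RingOfIntegers.ext (congrFun h0 l))
  rw [← NumberField.RingOfIntegers.coe_ne_zero_iff]
  exact (coe_reducedNorm σ γ x).trans_ne (h.det_twistedCirculant_ne_zero hx')

theorem IsNonNorm.smul_reducedNorm [NeZero n] (h : IsNonNorm n σ (γ : K)) (x : Fin n → 𝓞 L) :
    σ • reducedNorm σ γ x = reducedNorm σ γ x := by
  rcases eq_or_ne n 1 with rfl | hn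
  · rw [← pow_one σ, h.pow_eq_one, one_smul]
  · have hγ : γ ≠ 0 := by
      rintro rfl
      have := NeZero.pos n
      exact h.norm_ne_pow 1 le_rfl (by lia) 0 (by simp)
    exact smul_det_twistedCirculant h.pow_eq_one (smul_algebraMap σ γ)
      (by simpa using hγ) x

theorem IsNonNorm.exists_algebraMap_eq_reducedNorm [NeZero n] (h : IsNonNorm n σ (γ : K))
    (x : Fin n → 𝓞 L) : ∃ d : 𝓞 K, algebraMap (𝓞 K) (𝓞 L) d = reducedNorm σ γ x := by
  refine Algebra.IsInvariant.isInvariant (G := L ≃ₐ[K] L) _ fun τ => ?_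
  have hσ : σ ∈ MulAction.stabilizer (L ≃ₐ[K] L) (reducedNorm σ γ x) := h.smul_reducedNorm x
  exact Subgroup.zpowers_le.mpr hσ (h.mem_zpowers τ)

theorem IsNonNorm.absNorm_le_absNorm [NeZero n] (h : IsNonNorm n σ (γ : K)) {x : Fin n → 𝓞 L}
    (hx : x ≠ 0) {d : 𝓞 K} (hd : algebraMap (𝓞 K) (𝓞 L) d = reducedNorm σ γ x)
    {Q : Ideal (𝓞 L)} (hQ : ∀ l, x l ∈ Q) :
    Ideal.absNorm Q ≤ Ideal.absNorm (Ideal.span {d}) := by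
  have hd0 : d ≠ 0 := by
    rintro rfl
    exact h.reducedNorm_ne_zero hx (by rw [← hd, map_zero])
  have hdvd : Ideal.absNorm Q ^ n ∣ Ideal.absNorm (Ideal.span {d}) ^ n := by
    have hmem := det_twistedCirculant_mem_prod σ (algebraMap (𝓞 K) (𝓞 L) γ) hQ
    rw [← reducedNorm, ← hd, ← Ideal.span_singleton_le_iff_mem] at hmem
    have hnorm := Ideal.absNorm_dvd_absNorm_of_le hmem
    simp only [map_prod, absNorm_smul, Finset.prod_const, Finset.card_univ,
      Fintype.card_fin] at hnorm
    rwa [← Set.image_singleton, ← Ideal.map_span, Ideal.absNorm_algebraMap (𝓞 K) (𝓞 L),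
      ← IsFractionRing.finrank_eq (𝓞 K) K (𝓞 L) L, h.finrank_eq] at hnorm
  exact Nat.le_of_dvd (absNorm_pos (Ideal.span_singleton_eq_bot.not.mpr hd0))
    ((Nat.pow_dvd_pow_iff (NeZero.ne n)).mp hdvd)

end ReducedNorm

section ImaginaryQuadratic

variable {K : Type*} [Field K] [NumberField K] [Algebra.IsQuadraticExtension ℚ K]
  [NumberField.IsTotallyComplex K]

open NumberField NumberField.InfinitePlace in
theorem norm_sq_eq_abs_norm (φ : K →+* ℂ) (a : K) : ‖φ a‖ ^ 2 = |(Algebra.norm ℚ a : ℝ)| := by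
  have hcard : Fintype.card (InfinitePlace K) = 1 := by
    have hdeg := IsTotallyComplex.finrank K
    rw [Algebra.IsQuadraticExtension.finrank_eq_two] at hdeg
    rw [card_eq_nrRealPlaces_add_nrComplexPlaces, IsTotallyComplex.nrRealPlaces_eq_zero]
    lia
  have : Subsingleton (InfinitePlace K) := Fintype.card_le_one_iff_subsingleton.mp hcard.le
  have hprod := prod_eq_abs_norm a
  rwa [Fintype.prod_subsingleton _ (InfinitePlace.mk φ), IsTotallyComplex.mult_eq,
    InfinitePlace.apply, Rat.cast_abs] at hprod

theorem absNorm_span_singleton_eq_abs_norm {L : Type*} [Field L] [NumberField L] (y : 𝓞 L) :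
    (Ideal.absNorm (Ideal.span {y}) : ℝ) = |(Algebra.norm ℚ (y : L) : ℝ)| := by
  rw [Ideal.absNorm_span_singleton, ← Algebra.coe_norm_int, Nat.cast_natAbs, Int.cast_abs,
    Rat.cast_intCast]

theorem IsGaloisGenerator.norm_sq_map_prod {L : Type*} [Field L] [NumberField L] [Algebra K L]
    [IsGalois K L] {n : ℕ} {σ : L ≃ₐ[K] L} (h : IsGaloisGenerator n σ) (ι : L →+* ℂ) (y : 𝓞 L) :
    ‖ι (∏ i ∈ Finset.range n, σ ^ i • (y : L))‖ ^ 2 = Ideal.absNorm (Ideal.span {y}) := by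
  rw [← h.algebraMap_norm, ← RingHom.comp_apply, norm_sq_eq_abs_norm, Algebra.norm_norm,
    absNorm_span_singleton_eq_abs_norm]

end ImaginaryQuadratic

section Codeword

variable {K L : Type*} [Field K] [Field L] [Algebra K L] {n : ℕ}

theorem codeword_sub (ι : L →+* ℂ) (σ : L ≃ₐ[K] L) (γ : 𝓞 K) (α : 𝓞 L) (x y : Fin n → 𝓞 L) :
    codeword ι σ γ α (x - y) = codeword ι σ γ α x - codeword ι σ γ α y := by
  have hsub : cyclicMatrix σ γ (x - y) = cyclicMatrix σ γ x - cyclicMatrix σ γ y := by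
    simp only [cyclicMatrix_eq_twistedCirculant, ← twistedCirculant_sub]
    rfl
  rw [codeword, hsub, Matrix.mul_sub, Matrix.map_sub _ (map_sub ι)]
  rfl

theorem codeword_add (ι : L →+* ℂ) (σ : L ≃ₐ[K] L) (γ : 𝓞 K) (α : 𝓞 L) (x y : Fin n → 𝓞 L) :
    codeword ι σ γ α (x + y) = codeword ι σ γ α x + codeword ι σ γ α y := by
  rw [← sub_eq_iff_eq_add, ← codeword_sub, add_sub_cancel_right]

theorem det_codeword (ι : L →+* ℂ) (σ : L ≃ₐ[K] L) (γ : 𝓞 K) (α : 𝓞 L) (x : Fin n → 𝓞 L) :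
    (codeword ι σ γ α x).det =
      ι (∏ i ∈ Finset.range n, σ ^ i • (α : L)) * ι (cyclicMatrix σ γ x).det := by
  rw [codeword, ← RingHom.mapMatrix_apply, ← RingHom.map_det, Matrix.det_mul, map_mul,
    Matrix.det_diagonal, Fin.prod_univ_eq_prod_range (fun i => (σ ^ i) (α : L))]
  rfl

theorem det_cyclicMatrix_single [NeZero n] (σ : L ≃ₐ[K] L) (γ : 𝓞 K) (y : 𝓞 L) :
    (cyclicMatrix σ γ (Pi.single (0 : Fin n) y)).det =
      ∏ i ∈ Finset.range n, σ ^ i • (y : L) := by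
  rw [← coe_reducedNorm, reducedNorm, twistedCirculant_single, Matrix.det_diagonal,
    Fin.prod_univ_eq_prod_range (fun i => σ ^ i • y)]
  exact map_prod (algebraMap (𝓞 L) L) _ _

variable [NumberField K] [NumberField L] [IsGalois K L] [NeZero n] {σ : L ≃ₐ[K] L} {γ : 𝓞 K}

theorem IsNonNorm.codeword_injective (h : IsNonNorm n σ (γ : K)) (ι : L →+* ℂ) {α : 𝓞 L}
    (hα : α ≠ 0) : Function.Injective (codeword (n := n) ι σ γ α) := by
  intro x x' hxx'
  by_contra hne
  have hα' : (α : L) ≠ 0 := NumberField.RingOfIntegers.coe_ne_zero_iff.mpr hα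
  have hprod : ∏ i ∈ Finset.range n, σ ^ i • (α : L) ≠ 0 :=
    Finset.prod_ne_zero_iff.mpr fun i _ => (smul_ne_zero_iff_ne (σ ^ i)).mpr hα'
  have hnorm : (cyclicMatrix σ γ (x - x')).det ≠ 0 := by
    rw [← coe_reducedNorm]
    exact NumberField.RingOfIntegers.coe_ne_zero_iff.mpr
      (h.reducedNorm_ne_zero (sub_ne_zero.mpr hne))
  have hdet : (codeword ι σ γ α (x - x')).det = 0 := by
    rw [codeword_sub, hxx', sub_self, Matrix.det_zero]
  rw [det_codeword, mul_eq_zero, map_eq_zero, map_eq_zero] at hdet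
  exact hdet.elim hprod hnorm

variable [Algebra.IsQuadraticExtension ℚ K] [NumberField.IsTotallyComplex K]

theorem IsNonNorm.exists_norm_sq_det_codeword (h : IsNonNorm n σ (γ : K)) (ι : L →+* ℂ)
    (α : 𝓞 L) {x : Fin n → 𝓞 L} (hx : x ≠ 0) :
    ∃ N : ℕ, ‖(codeword ι σ γ α x).det‖ ^ 2 = Ideal.absNorm (Ideal.span {α}) * (N : ℝ) ∧
      ∀ Q : Ideal (𝓞 L), (∀ l, x l ∈ Q) → Ideal.absNorm Q ≤ N := by
  obtain ⟨d, hd⟩ := h.exists_algebraMap_eq_reducedNorm x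
  refine ⟨Ideal.absNorm (Ideal.span {d}), ?_, fun Q hQ => h.absNorm_le_absNorm hx hd hQ⟩
  have hdet : (cyclicMatrix σ γ x).det = algebraMap K L d := by rw [← coe_reducedNorm, ← hd]; rfl
  rw [det_codeword, norm_mul, mul_pow, h.norm_sq_map_prod, hdet, ← RingHom.comp_apply,
    norm_sq_eq_abs_norm, absNorm_span_singleton_eq_abs_norm d]

theorem IsGaloisGenerator.norm_sq_det_codeword_single (h : IsGaloisGenerator n σ) (ι : L →+* ℂ)
    (γ : 𝓞 K) (α y : 𝓞 L) :
    ‖(codeword ι σ γ α (Pi.single (0 : Fin n) y)).det‖ ^ 2 =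
      Ideal.absNorm (Ideal.span {α}) * (Ideal.absNorm (Ideal.span {y}) : ℝ) := by
  rw [det_codeword, det_cyclicMatrix_single, norm_mul, mul_pow, h.norm_sq_map_prod,
    h.norm_sq_map_prod]

end Codeword

section MinimumDeterminant

variable {n : ℕ}

theorem re_det_mul_conjTranspose (A : Matrix (Fin n) (Fin n) ℂ) :
    (A * Aᴴ).det.re = ‖A.det‖ ^ 2 := by
  rw [Matrix.det_mul, Matrix.det_conjTranspose, Complex.star_def, Complex.mul_conj,
    Complex.ofReal_re, Complex.normSq_eq_norm_sq]

theorem hasMinDet_of_multiples {C : Set (Matrix (Fin n) (Fin n) ℂ)} {a : ℝ} (ha : 0 < a)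
    {b : ℕ} (hb : 0 < b) (h : ∀ d ∈ pairDets C, ∃ N : ℕ, b ≤ N ∧ a * N = d)
    (hne : (pairDets C).Nonempty) : HasMinDet C ∧ a * b ≤ minDet C := by
  classical
  have hex : ∃ N : ℕ, a * N ∈ pairDets C := by
    obtain ⟨d, hd⟩ := hne
    obtain ⟨N, -, rfl⟩ := h d hd
    exact ⟨N, hd⟩
  have hleast : IsLeast (pairDets C) (a * Nat.find hex) := by
    refine ⟨Nat.find_spec hex, fun d hd => ?_⟩
    obtain ⟨N, -, rfl⟩ := h d hd
    gcongr
    exact Nat.find_min' hex hd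
  have hmin : IsLeast (pairDets C) (minDet C) := by rwa [minDet, hleast.csInf_eq]
  have hle : a * b ≤ minDet C := by
    obtain ⟨N, hbN, hN⟩ := h _ hmin.1
    rw [← hN]
    gcongr
  exact ⟨⟨hmin, hle.trans_lt' (by positivity)⟩, hle⟩

theorem sideInfoGain_eq_mul_div {C CS : Set (Matrix (Fin n) (Fin n) ℂ)} {R N : ℝ}
    (hR : n * R = Real.logb 2 N / 2) :
    sideInfoGain C CS R =
      20 * Real.logb 10 2 * (Real.log (minDet CS / minDet C) / Real.log N) := by
  have h2 : Real.log 2 ≠ 0 := (Real.log_pos one_lt_two).ne'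
  simp only [sideInfoGain, hR, Real.logb]
  field_simp
  ring

theorem le_sideInfoGain {C CS : Set (Matrix (Fin n) (Fin n) ℂ)} {R N : ℝ}
    (hR : n * R = Real.logb 2 N / 2) (hN : 1 < N) (hC : 0 < minDet C)
    (h : minDet C * N ≤ minDet CS) : 20 * Real.logb 10 2 ≤ sideInfoGain C CS R := by
  have hratio : N ≤ minDet CS / minDet C := by rwa [le_div_iff₀' hC]
  have hlog : 0 ≤ Real.logb 10 2 := Real.logb_nonneg (by norm_num) one_le_two
  rw [sideInfoGain_eq_mul_div hR]
  refine le_mul_of_one_le_right (by positivity) ?_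
  rw [one_le_div (Real.log_pos hN)]
  gcongr

theorem sideInfoGain_eq {C CS : Set (Matrix (Fin n) (Fin n) ℂ)} {R N : ℝ}
    (hR : n * R = Real.logb 2 N / 2) (hN : 1 < N) (hC : 0 < minDet C)
    (h : minDet CS = minDet C * N) : sideInfoGain C CS R = 20 * Real.logb 10 2 := by
  rw [sideInfoGain_eq_mul_div hR, h, mul_div_cancel_left₀ _ hC.ne', div_self (Real.log_pos hN).ne',
    mul_one]

end MinimumDeterminant

section Rate

variable {L : Type*} [Field L] [NumberField L] {m : ℕ} {q : Fin m → Ideal (𝓞 L)}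
  {S : Finset (Fin m)}

theorem natCast_mul_sideInfoRate {n : ℕ} [NeZero n] (hq0 : ∀ k ∈ S, q k ≠ ⊥) :
    n * sideInfoRate n q S = Real.logb 2 (Ideal.absNorm (∏ s ∈ S, q s)) / 2 := by
  rw [map_prod, Nat.cast_prod, Real.logb_prod, sideInfoRate, Finset.mul_sum, Finset.sum_div]
  · refine Finset.sum_congr rfl fun s _ => ?_
    rw [Nat.card_fun, Nat.card_fin, Nat.cast_pow, Real.logb_pow, ← Submodule.cardQuot_apply,
      ← Ideal.absNorm_apply]
    have hn : (n : ℝ) ≠ 0 := NeZero.ne _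
    field_simp
  · exact fun s hs => Nat.cast_ne_zero.mpr (mt Ideal.absNorm_eq_zero_iff.mp (hq0 s hs))

theorem one_lt_absNorm_prod (hq0 : ∀ k ∈ S, q k ≠ ⊥) (hS : ∃ s ∈ S, q s ≠ ⊤) :
    1 < Ideal.absNorm (∏ s ∈ S, q s) := by
  obtain ⟨s, hsS, hs⟩ := hS
  have h0 : Ideal.absNorm (∏ s ∈ S, q s) ≠ 0 :=
    mt Ideal.absNorm_eq_zero_iff.mp (Finset.prod_ne_zero_iff.mpr hq0)
  have h1 : Ideal.absNorm (∏ s ∈ S, q s) ≠ 1 := fun h =>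
    hs (top_le_iff.mp ((Ideal.absNorm_eq_one_iff.mp h).ge.trans
      (Ideal.prod_le_inf.trans (Finset.inf_le hsS))))
  lia

theorem sideInfoRate_pos {n : ℕ} [NeZero n] (hq0 : ∀ k ∈ S, q k ≠ ⊥) (hS : ∃ s ∈ S, q s ≠ ⊤) :
    0 < sideInfoRate n q S := by
  have hlog : 0 < Real.logb 2 (Ideal.absNorm (∏ s ∈ S, q s)) :=
    Real.logb_pos one_lt_two (Nat.one_lt_cast.mpr (one_lt_absNorm_prod hq0 hS))
  refine pos_of_mul_pos_right (a := (n : ℝ)) ?_ n.cast_nonneg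
  rw [natCast_mul_sideInfoRate hq0]
  positivity

end Rate

section CompatibleCode

variable {K L : Type*} [Field K] [Field L] [Algebra K L] {n m : ℕ} {ι : L →+* ℂ} {σ : L ≃ₐ[K] L}
  {γ : 𝓞 K} {α : 𝓞 L} {q : Fin m → Ideal (𝓞 L)} {M : ((k : Fin m) → 𝓞 L ⧸ q k) → 𝓞 L}
  {S : Finset (Fin m)} {v : Messages n q}

/-- The matrices `X(x)`, `x ∈ 𝓞_Lⁿ`, whose residues agree with the side information
`w_s = v_s`, `s ∈ S`. Every code with this side information is a subset. -/
def compatibleCode (ι : L →+* ℂ) (σ : L ≃ₐ[K] L) (γ : 𝓞 K) (α : 𝓞 L) (q : Fin m → Ideal (𝓞 L))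
    (S : Finset (Fin m)) (v : Messages n q) : Set (Matrix (Fin n) (Fin n) ℂ) :=
  {X | ∃ x : Fin n → 𝓞 L, (∀ k ∈ S, ∀ l, Ideal.Quotient.mk (q k) (x l) = v k l) ∧
    X = codeword ι σ γ α x}

theorem codebook_eq_subcode_empty (v : Messages n q) :
    codebook ι σ γ α q M = subcode ι σ γ α q M ∅ v := by
  simp [codebook, subcode]

theorem IsLeaderMap.subcode_subset_compatibleCode (hM : IsLeaderMap q M) :
    subcode ι σ γ α q M S v ⊆ compatibleCode ι σ γ α q S v := by
  rintro _ ⟨w, hw, rfl⟩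
  exact ⟨_, fun k hk l => by rw [hM, hw k hk], rfl⟩

theorem mem_prod_iff_forall_mem {R : Type*} [CommRing R] {q : Fin m → Ideal R}
    (hq : Pairwise fun j k => IsCoprime (q j) (q k)) {x : R} :
    x ∈ ∏ k ∈ S, q k ↔ ∀ k ∈ S, x ∈ q k := by
  rw [Ideal.prod_eq_iInf_of_pairwise_isCoprime fun i _ j _ hij => hq hij]
  simp only [Submodule.mem_iInf]

theorem IsLeaderMap.latticeCode_subcode (hM : IsLeaderMap q M)
    (hq : Pairwise fun j k => IsCoprime (q j) (q k)) :
    latticeCode ι σ γ α q (subcode ι σ γ α q M S v) = compatibleCode ι σ γ α q S v := by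
  apply Set.Subset.antisymm
  · rintro _ ⟨Y, hY, z, hz, rfl⟩
    obtain ⟨x, hx, rfl⟩ := hM.subcode_subset_compatibleCode hY
    refine ⟨x + z, fun k hk l => ?_, (codeword_add ι σ γ α x z).symm⟩
    have hzk : Ideal.Quotient.mk (q k) (z l) = 0 := Ideal.Quotient.eq_zero_iff_mem.mpr
      ((mem_prod_iff_forall_mem hq).mp (hz l) k (Finset.mem_univ k))
    rw [Pi.add_apply, map_add, hzk, add_zero, hx k hk]
  · rintro _ ⟨x, hx, rfl⟩
    let y : Fin n → 𝓞 L := fun l => M fun k => Ideal.Quotient.mk (q k) (x l)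
    refine ⟨codeword ι σ γ α y, ⟨fun k l => Ideal.Quotient.mk (q k) (x l), ?_, rfl⟩, x - y,
      fun l => (mem_prod_iff_forall_mem hq).mpr fun k _ => ?_, ?_⟩
    · exact fun k hk => funext fun l => hx k hk l
    · rw [Pi.sub_apply, ← Ideal.Quotient.mk_eq_mk_iff_sub_mem, hM]
    · rw [← codeword_add, add_sub_cancel]

variable [NumberField K] [NumberField L] [IsGalois K L] [NeZero n]
  [Algebra.IsQuadraticExtension ℚ K] [NumberField.IsTotallyComplex K]

theorem IsNonNorm.hasMinDet_of_subset_compatibleCode (h : IsNonNorm n σ (γ : K)) (hα : α ≠ 0)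
    (hq0 : ∀ k ∈ S, q k ≠ ⊥) (hq : Pairwise fun j k => IsCoprime (q j) (q k))
    {D : Set (Matrix (Fin n) (Fin n) ℂ)} (hD : D ⊆ compatibleCode ι σ γ α q S v)
    (hne : (pairDets D).Nonempty) :
    HasMinDet D ∧ (Ideal.absNorm (Ideal.span {α}) : ℝ) * Ideal.absNorm (∏ k ∈ S, q k) ≤
      minDet D := by
  refine hasMinDet_of_multiples ?_ ?_ ?_ hne
  · exact Nat.cast_pos.mpr (absNorm_pos (Ideal.span_singleton_eq_bot.not.mpr hα))
  · exact absNorm_pos (Finset.prod_ne_zero_iff.mpr hq0)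
  · rintro _ ⟨X, hX, X', hX', hne, rfl⟩
    obtain ⟨x, hx, rfl⟩ := hD hX
    obtain ⟨x', hx', rfl⟩ := hD hX'
    have hsub : x - x' ≠ 0 := sub_ne_zero.mpr (ne_of_apply_ne _ hne)
    obtain ⟨N, hN, hle⟩ := h.exists_norm_sq_det_codeword ι α hsub
    refine ⟨N, hle _ fun l => (mem_prod_iff_forall_mem hq).mpr fun k hk => ?_, ?_⟩
    · rw [Pi.sub_apply, ← Ideal.Quotient.mk_eq_mk_iff_sub_mem, hx k hk, hx' k hk]
    · rw [← codeword_sub, re_det_mul_conjTranspose, hN]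

theorem IsNonNorm.mem_pairDets_of_codeword_mem (h : IsNonNorm n σ (γ : K)) (hα : α ≠ 0)
    {D : Set (Matrix (Fin n) (Fin n) ℂ)} {x : Fin n → 𝓞 L} {y : 𝓞 L} (hy : y ≠ 0)
    (hx : codeword ι σ γ α x ∈ D) (hxy : codeword ι σ γ α (x + Pi.single 0 y) ∈ D) :
    (Ideal.absNorm (Ideal.span {α}) : ℝ) * Ideal.absNorm (Ideal.span {y}) ∈ pairDets D := by
  refine ⟨_, hxy, _, hx, (h.codeword_injective ι hα).ne ?_, ?_⟩
  · simpa using hy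
  · rw [← codeword_sub, add_sub_cancel_left, re_det_mul_conjTranspose,
      h.norm_sq_det_codeword_single]

theorem IsNonNorm.mem_pairDets_compatibleCode (h : IsNonNorm n σ (γ : K)) (hα : α ≠ 0)
    (hq : Pairwise fun j k => IsCoprime (q j) (q k)) {y : 𝓞 L} (hy : y ≠ 0)
    (hyS : y ∈ ∏ k ∈ S, q k) :
    (Ideal.absNorm (Ideal.span {α}) : ℝ) * Ideal.absNorm (Ideal.span {y}) ∈
      pairDets (compatibleCode ι σ γ α q S v) := by
  choose x hx using fun l => Ideal.pi_quotient_surjective hq fun k => v k l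
  refine h.mem_pairDets_of_codeword_mem hα hy ⟨x, fun k _ l => hx l k, rfl⟩
    ⟨_, fun k hk l => ?_, rfl⟩
  have hmem : (Pi.single 0 y : Fin n → 𝓞 L) l ∈ q k := by
    rcases eq_or_ne l 0 with rfl | hl
    · rw [Pi.single_eq_same]
      exact (mem_prod_iff_forall_mem hq).mp hyS k hk
    · rw [Pi.single_eq_of_ne hl]
      exact zero_mem _
  rw [Pi.add_apply, map_add, Ideal.Quotient.eq_zero_iff_mem.mpr hmem, add_zero, hx]

theorem IsNonNorm.hasMinDet_compatibleCode (h : IsNonNorm n σ (γ : K)) (hα : α ≠ 0)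
    (hq0 : ∀ k ∈ S, q k ≠ ⊥) (hq : Pairwise fun j k => IsCoprime (q j) (q k)) :
    HasMinDet (compatibleCode ι σ γ α q S v) ∧
      (Ideal.absNorm (Ideal.span {α}) : ℝ) * Ideal.absNorm (∏ k ∈ S, q k) ≤
        minDet (compatibleCode ι σ γ α q S v) := by
  obtain ⟨y, hy, hy0⟩ :=
    Submodule.exists_mem_ne_zero_of_ne_bot (Finset.prod_ne_zero_iff.mpr hq0)
  exact h.hasMinDet_of_subset_compatibleCode hα hq0 hq subset_rfl
    ⟨_, h.mem_pairDets_compatibleCode hα hq hy0 hy⟩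

theorem IsNonNorm.minDet_compatibleCode (h : IsNonNorm n σ (γ : K)) (hα : α ≠ 0)
    (hq0 : ∀ k ∈ S, q k ≠ ⊥) (hq : Pairwise fun j k => IsCoprime (q j) (q k))
    (hprin : (∏ k ∈ S, q k).IsPrincipal) :
    minDet (compatibleCode ι σ γ α q S v) =
      Ideal.absNorm (Ideal.span {α}) * Ideal.absNorm (∏ k ∈ S, q k) := by
  obtain ⟨hmin, hle⟩ := h.hasMinDet_compatibleCode hα hq0 hq (ι := ι) (v := v)
  refine hle.antisymm' (hmin.1.2 ?_)
  obtain ⟨g, hg : ∏ k ∈ S, q k = Ideal.span {g}⟩ := hprin.principal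
  have hg0 : g ≠ 0 := by
    rintro rfl
    exact Finset.prod_ne_zero_iff.mpr hq0 (hg.trans (by simp))
  have hmem : g ∈ ∏ k ∈ S, q k := hg ▸ Ideal.mem_span_singleton_self g
  nth_rw 1 [hg]
  exact h.mem_pairDets_compatibleCode hα hq hg0 hmem

end CompatibleCode

section Energy

theorem prod_le_one_of_sum_le_card {ν : Type*} {s : Finset ν} {f : ν → ℝ}
    (hf : ∀ i ∈ s, 0 ≤ f i) (h : ∑ i ∈ s, f i ≤ s.card) : ∏ i ∈ s, f i ≤ 1 := by
  calc ∏ i ∈ s, f i ≤ ∏ i ∈ s, Real.exp (f i - 1) :=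
        Finset.prod_le_prod hf fun i _ => by simpa using Real.add_one_le_exp (f i - 1)
    _ = Real.exp (∑ i ∈ s, f i - s.card) := by
        rw [← Real.exp_sum, Finset.sum_sub_distrib, Finset.sum_const, nsmul_one]
    _ ≤ 1 := Real.exp_le_one_iff.mpr (sub_nonpos.mpr h)

variable {K L : Type*} [Field K] [Field L] [Algebra K L] {n m : ℕ} {ι : L →+* ℂ} {σ : L ≃ₐ[K] L}

theorem energy_zero : energy n ι σ 0 = 0 := by
  simp [energy]

theorem energy_one : energy n ι σ 1 = n := by
  simp [energy]

theorem eq_zero_of_energy_nonpos [NeZero n] {x : 𝓞 L} (h : energy n ι σ x ≤ 0) : x = 0 := by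
  have hnonneg : ∀ i ∈ Finset.range n, 0 ≤ ‖ι ((σ ^ i) (x : L))‖ ^ 2 := fun i _ => by positivity
  have hzero := (Finset.sum_eq_zero_iff_of_nonneg hnonneg).mp
    (h.antisymm (Finset.sum_nonneg hnonneg)) 0 (Finset.mem_range.mpr (NeZero.pos n))
  simpa using hzero

theorem IsGaloisGenerator.absNorm_le_one_of_energy_le [NumberField K] [NumberField L]
    [IsGalois K L] [Algebra.IsQuadraticExtension ℚ K] [NumberField.IsTotallyComplex K]
    (h : IsGaloisGenerator n σ) {x : 𝓞 L} (hx : energy n ι σ x ≤ n) :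
    Ideal.absNorm (Ideal.span {x}) ≤ 1 := by
  have hle : ∏ i ∈ Finset.range n, ‖ι ((σ ^ i) (x : L))‖ ^ 2 ≤ 1 :=
    prod_le_one_of_sum_le_card (fun i _ => by positivity) (by rwa [Finset.card_range])
  rw [Finset.prod_pow, ← norm_prod, ← map_prod] at hle
  exact_mod_cast (h.norm_sq_map_prod ι x).symm.trans_le hle

variable {q : Fin m → Ideal (𝓞 L)} {M : ((k : Fin m) → 𝓞 L ⧸ q k) → 𝓞 L}

theorem HasMinEnergy.leader_zero [NeZero n] (hE : HasMinEnergy n ι σ q M) : M 0 = 0 :=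
  eq_zero_of_energy_nonpos ((hE 0 0 fun _ => rfl).trans_eq energy_zero)

theorem IsLeaderMap.leader_one_ne_zero (hM : IsLeaderMap q M) (hq1 : ∃ k, q k ≠ ⊤) : M 1 ≠ 0 := by
  intro h
  obtain ⟨k, hk⟩ := hq1
  have : Nontrivial (𝓞 L ⧸ q k) := Ideal.Quotient.nontrivial_iff.mpr hk
  have hone := hM 1 k
  rw [h, map_zero] at hone
  exact zero_ne_one hone

theorem HasMinEnergy.absNorm_leader_one [NumberField K] [NumberField L] [IsGalois K L]
    [Algebra.IsQuadraticExtension ℚ K] [NumberField.IsTotallyComplex K]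
    (hE : HasMinEnergy n ι σ q M) (h : IsGaloisGenerator n σ) (hM : IsLeaderMap q M)
    (hq1 : ∃ k, q k ≠ ⊤) : Ideal.absNorm (Ideal.span {M 1}) = 1 := by
  refine le_antisymm (h.absNorm_le_one_of_energy_le ((hE 1 1 fun _ => rfl).trans_eq energy_one)) ?_
  exact absNorm_pos (Ideal.span_singleton_eq_bot.not.mpr (hM.leader_one_ne_zero hq1))

end Energy

section FiniteCodebook

variable {K L : Type*} [Field K] [NumberField K] [Field L] [NumberField L] [Algebra K L]
  [IsGalois K L] {n m : ℕ} [NeZero n] {ι : L →+* ℂ} {σ : L ≃ₐ[K] L} {γ : 𝓞 K} {α : 𝓞 L}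
  {q : Fin m → Ideal (𝓞 L)} {M : ((k : Fin m) → 𝓞 L ⧸ q k) → 𝓞 L} {S : Finset (Fin m)}
  {v : Messages n q} [Algebra.IsQuadraticExtension ℚ K] [NumberField.IsTotallyComplex K]

theorem IsNonNorm.hasMinDet_codebook (h : IsNonNorm n σ (γ : K)) (hα : α ≠ 0)
    (hq : Pairwise fun j k => IsCoprime (q j) (q k)) (hM : IsLeaderMap q M)
    (hE : HasMinEnergy n ι σ q M) (hq1 : ∃ k, q k ≠ ⊤) :
    HasMinDet (codebook (n := n) ι σ γ α q M) ∧
      minDet (codebook (n := n) ι σ γ α q M) = Ideal.absNorm (Ideal.span {α}) := by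
  have hmem : (Ideal.absNorm (Ideal.span {α}) : ℝ) ∈
      pairDets (codebook (n := n) ι σ γ α q M) := by
    have hdet := h.mem_pairDets_of_codeword_mem hα (ι := ι) (x := 0)
      (D := codebook (n := n) ι σ γ α q M) (hM.leader_one_ne_zero hq1) ⟨0, ?_⟩
      ⟨fun _ => Pi.single 0 1, ?_⟩
    · rwa [hE.absNorm_leader_one h.toIsGaloisGenerator hM hq1, Nat.cast_one, mul_one] at hdet
    · exact congrArg _ (funext fun _ => hE.leader_zero.symm)
    · refine congrArg _ (funext fun l => ?_)
      rw [zero_add]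
      rcases eq_or_ne l 0 with rfl | hl
      · simp only [Pi.single_eq_same]; rfl
      · simp only [Pi.single_eq_of_ne hl]; exact hE.leader_zero.symm
  have hsub : codebook (n := n) ι σ γ α q M ⊆ compatibleCode ι σ γ α q ∅ 0 := by
    rw [codebook_eq_subcode_empty 0]
    exact hM.subcode_subset_compatibleCode
  obtain ⟨hmin, hle⟩ := h.hasMinDet_of_subset_compatibleCode hα (by simp) hq hsub ⟨_, hmem⟩
  rw [Finset.prod_empty, map_one, Nat.cast_one, mul_one] at hle
  exact ⟨hmin, hle.antisymm' (hmin.1.2 hmem)⟩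

theorem IsNonNorm.hasMinDet_subcode (h : IsNonNorm n σ (γ : K)) (hα : α ≠ 0)
    (hq0 : ∀ k ∈ S, q k ≠ ⊥) (hq : Pairwise fun j k => IsCoprime (q j) (q k))
    (hM : IsLeaderMap q M) (hq1 : ∃ k, k ∉ S ∧ q k ≠ ⊤) :
    HasMinDet (subcode ι σ γ α q M S v) ∧
      (Ideal.absNorm (Ideal.span {α}) : ℝ) * Ideal.absNorm (∏ k ∈ S, q k) ≤
        minDet (subcode ι σ γ α q M S v) := by
  refine h.hasMinDet_of_subset_compatibleCode hα hq0 hq hM.subcode_subset_compatibleCode ?_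
  obtain ⟨k₀, hk₀S, hk₀⟩ := hq1
  have : Nontrivial (𝓞 L ⧸ q k₀) := Ideal.Quotient.nontrivial_iff.mpr hk₀
  let w : Messages n q := Function.update v k₀ (v k₀ + 1)
  refine ⟨_, _, ⟨v, fun _ _ => rfl, rfl⟩, _, ⟨w, fun k hk => ?_, rfl⟩, fun hvw => ?_, rfl⟩
  · exact Function.update_of_ne (ne_of_mem_of_not_mem hk hk₀S) _ _
  · have hlayer := congrFun (h.codeword_injective ι hα hvw) 0
    have hres := congrArg (Ideal.Quotient.mk (q k₀)) hlayer
    simp [hM _ k₀, w] at hres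

end FiniteCodebook

section BaseField

variable {K : Type*} [Field K] [NumberField K]

theorem isQuadraticExtension_of_isCyclotomicExtension
    (hK : IsCyclotomicExtension {4} ℚ K ∨ IsCyclotomicExtension {3} ℚ K) :
    Algebra.IsQuadraticExtension ℚ K where
  finrank_eq_two' := by
    rcases hK with h | h
    · exact IsCyclotomicExtension.Rat.finrank 4 K
    · exact IsCyclotomicExtension.Rat.finrank 3 K

theorem isTotallyComplex_of_isCyclotomicExtension
    (hK : IsCyclotomicExtension {4} ℚ K ∨ IsCyclotomicExtension {3} ℚ K) :
    NumberField.IsTotallyComplex K := by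
  rcases hK with h | h
  · exact IsCyclotomicExtension.Rat.isTotallyComplex (n := 4) K (by norm_num)
  · exact IsCyclotomicExtension.Rat.isTotallyComplex (n := 3) K (by norm_num)

end BaseField

theorem isPrincipal_prod {R ν : Type*} [CommRing R] {s : Finset ν} {I : ν → Ideal R}
    (h : ∀ k ∈ s, (I k).IsPrincipal) : (∏ k ∈ s, I k).IsPrincipal :=
  Submonoid.prod_mem (Ideal.isPrincipalSubmonoid R) h

end LSTIC

open LSTIC in
theorem theorem1_general {K L : Type*} [Field K] [NumberField K] [Field L] [NumberField L]
    [Algebra K L] [IsGalois K L] [Algebra.IsQuadraticExtension ℚ K]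
    [NumberField.IsTotallyComplex K] (ι : L →+* ℂ) {n : ℕ} {σ : L ≃ₐ[K] L} {γ : 𝓞 K}
    (h : IsNonNorm n σ (γ : K)) {α : 𝓞 L} (hα : α ≠ 0) {m : ℕ} {q : Fin m → Ideal (𝓞 L)}
    {S : Finset (Fin m)} (hq0 : ∀ k ∈ S, q k ≠ ⊥)
    (hq : Pairwise fun j k => IsCoprime (q j) (q k))
    {M : ((k : Fin m) → 𝓞 L ⧸ q k) → 𝓞 L} (hM : IsLeaderMap q M) (hS : ∃ s ∈ S, q s ≠ ⊤)
    (v : Messages n q) {C CS Λ ΛS : Set (Matrix (Fin n) (Fin n) ℂ)} {R : ℝ}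
    (hC : C = codebook ι σ γ α q M) (hCS : CS = subcode ι σ γ α q M S v)
    (hΛ : Λ = latticeCode ι σ γ α q C) (hΛS : ΛS = latticeCode ι σ γ α q CS)
    (hR : R = sideInfoRate n q S) :
    (0 < R ∧ HasMinDet Λ ∧ HasMinDet ΛS ∧ 20 * Real.logb 10 2 ≤ sideInfoGain Λ ΛS R ∧
      ((∏ k ∈ S, q k).IsPrincipal → sideInfoGain Λ ΛS R = 20 * Real.logb 10 2)) ∧
    (HasMinEnergy n ι σ q M → (∃ k, k ∉ S ∧ q k ≠ ⊤) →
      HasMinDet C ∧ HasMinDet CS ∧ 20 * Real.logb 10 2 ≤ sideInfoGain C CS R) := by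
  have := h.neZero
  have hrate : n * R = _ := hR ▸ natCast_mul_sideInfoRate hq0
  have hN : (1 : ℝ) < Ideal.absNorm (∏ k ∈ S, q k) :=
    Nat.one_lt_cast.mpr (one_lt_absNorm_prod hq0 hS)
  rw [hC, codebook_eq_subcode_empty v, hM.latticeCode_subcode hq] at hΛ
  rw [hCS, hM.latticeCode_subcode hq] at hΛS
  have hΛmin : HasMinDet Λ := hΛ ▸ (h.hasMinDet_compatibleCode hα (by simp) hq).1
  have hΛdet : minDet Λ = Ideal.absNorm (Ideal.span {α}) := by
    simpa [← hΛ] using h.minDet_compatibleCode (ι := ι) (S := ∅) (v := v) hα (by simp) hq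
      (isPrincipal_prod (by simp))
  obtain ⟨hΛSmin, hΛSle⟩ := h.hasMinDet_compatibleCode (ι := ι) (v := v) hα hq0 hq
  rw [← hΛS] at hΛSmin hΛSle
  refine ⟨⟨hR ▸ sideInfoRate_pos hq0 hS, hΛmin, hΛSmin, ?_, fun hprin => ?_⟩, fun hE hq1 => ?_⟩
  · exact le_sideInfoGain hrate hN hΛmin.2 (hΛdet ▸ hΛSle)
  · refine sideInfoGain_eq hrate hN hΛmin.2 ?_
    rw [hΛdet, hΛS, h.minDet_compatibleCode hα hq0 hq hprin]
  · obtain ⟨hCmin, hCdet⟩ :=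
      h.hasMinDet_codebook (ι := ι) hα hq hM hE (hq1.imp fun _ hk => hk.2)
    obtain ⟨hCSmin, hCSle⟩ := h.hasMinDet_subcode (ι := ι) (v := v) hα hq0 hq hM hq1
    rw [← hC] at hCmin hCdet
    rw [← hCS] at hCSmin hCSle
    exact ⟨hCmin, hCSmin, le_sideInfoGain hrate hN hCmin.2 (hCdet ▸ hCSle)⟩

theorem theorem1 {K L : Type*} [Field K] [NumberField K] [Field L] [NumberField L]
    [Algebra K L] [IsGalois K L]
    -- the base field is `ℚ(i)` or `ℚ(ω)`
    (hK : IsCyclotomicExtension {4} ℚ K ∨ IsCyclotomicExtension {3} ℚ K)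
    (ι : L →+* ℂ) (n : ℕ) (hn : Module.finrank K L = n)
    -- the Galois group of `L/K` is cyclic, generated by `σ`
    (σ : L ≃ₐ[K] L) (hσ : ∀ τ : L ≃ₐ[K] L, τ ∈ Subgroup.zpowers σ)
    -- none of `γ, …, γⁿ⁻¹` is a norm from `L`
    (γ : 𝓞 K) (hγ : ∀ j : ℕ, 1 ≤ j → j < n → ∀ y : L, Algebra.norm K y ≠ (γ : K) ^ j)
    (α : 𝓞 L) (hα : α ≠ 0)
    (m : ℕ) (q : Fin m → Ideal (𝓞 L)) (hq0 : ∀ k, q k ≠ ⊥)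
    (hq : Pairwise fun j k => IsCoprime (q j) (q k))
    (M : ((k : Fin m) → 𝓞 L ⧸ q k) → 𝓞 L) (hM : LSTIC.IsLeaderMap q M)
    -- the side information, of positive rate
    (S : Finset (Fin m)) (hS : ∃ s ∈ S, q s ≠ ⊤) (v : LSTIC.Messages n q)
    -- the codebook, the subcode given the side information, and the rate of the latter
    (C CS : Set (Matrix (Fin n) (Fin n) ℂ)) (R : ℝ)
    (hC : C = LSTIC.codebook ι σ γ α q M) (hCS : CS = LSTIC.subcode ι σ γ α q M S v)
    (hR : R = LSTIC.sideInfoRate n q S)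
    -- the lattice codes from which the codebook and the subcode are carved
    (Λ ΛS : Set (Matrix (Fin n) (Fin n) ℂ))
    (hΛ : Λ = LSTIC.latticeCode ι σ γ α q C) (hΛS : ΛS = LSTIC.latticeCode ι σ γ α q CS) :
    -- minimum determinants taken over the lattice codes
    (0 < R ∧ LSTIC.HasMinDet Λ ∧ LSTIC.HasMinDet ΛS ∧
      20 * Real.logb 10 2 ≤ LSTIC.sideInfoGain Λ ΛS R ∧
      ((∀ k, (q k).IsPrincipal) → LSTIC.sideInfoGain Λ ΛS R = 20 * Real.logb 10 2)) ∧
    -- minimum determinants taken over the finite codebooks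
    (LSTIC.HasMinEnergy n ι σ q M → (∃ k, k ∉ S ∧ q k ≠ ⊤) →
      LSTIC.HasMinDet C ∧ LSTIC.HasMinDet CS ∧
      20 * Real.logb 10 2 ≤ LSTIC.sideInfoGain C CS R) := by
  have := LSTIC.isQuadraticExtension_of_isCyclotomicExtension hK
  have := LSTIC.isTotallyComplex_of_isCyclotomicExtension hK
  obtain ⟨⟨hRpos, hmin, hminS, hle, heq⟩, hfinite⟩ := theorem1_general ι ⟨⟨hn, hσ⟩, hγ⟩ hα
    (fun k _ => hq0 k) hq hM hS v hC hCS hΛ hΛS hR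
  exact ⟨⟨hRpos, hmin, hminS, hle, fun hprin => heq (LSTIC.isPrincipal_prod fun k _ => hprin k)⟩,
    hfinite⟩
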